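/- **Setting.** Fix a quantale $V$: a complete lattice with a commutative monoid structure $(\cdot,e)$ distributing over arbitrary joins; put $[x,y]=\bigvee\{s: x\cdot s\le y\}$ and $V_{\mathrm{int}}=\{q\in V: q\le e\}$. A *complete $V$-space* is a set with a symmetric $d:A\times A\to V$, $d(a,a)=\bot$, such that every sequence with $d(x_i,x_{i+1})\le r^i q$ for some $r<e$, $q<\top$ and $d(x_i,x_j)<\top$ for all $i,j$ has a unique limit point $L$, and $d(x_i,L)\le\bigvee_n\bigwedge_{j>n}d(x_i,x_j)$ (a limit point $y$ of $(x_n)$ satisfies: for every $r>\bot$, $d(y,x_n)\le r$ for all large $n$). Fix a complete $V$-space structure on $V_{\mathrm{int}}$ with nonexpansive multiplication (products carry the maximum distance). A *dilated space* is a complete $V$-space $A$ with a nonexpansive action $\star$ of $V_{\mathrm{int}}$ such that $\bot\star a$ does not depend on $a$ (it equals a base point of $A$), and a seminorm $|\cdot|:A\to V$ with $|q\star a|=q\cdot|a|$. A *dilated category* is a category whose hom-sets are dilated spaces, with $|\mathrm{id}|\le e$, $|g\circ f|\le|g|\cdot|f|$ and $(q\star g)\circ f=q\star(g\circ f)=g\circ(q\star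 f)$. Metric conditions on composition that one may impose in addition are: (N) composition is nonexpansive for the maximum distance; (L), (R) $d(f\circ g_1,f\circ g_2)\le|f|\cdot d(g_1,g_2)$, resp. $d(g_1\circ f,g_2\circ f)\le|f|\cdot d(g_1,g_2)$, whenever $d(g_1,g_2)<\top$. With (N), these are the categories enriched in dilated spaces. A dilated category is *monoidal* if its underlying category is monoidal with associators and unitors, and their inverses, of seminorm $\le e$; it is *pointwise additive* if each object $X$ carries a morphism $+_X:X\otimes X\to X$. A *lax monoidal dilated functor* is a lax monoidal functor of the underlying categories with $|Gf|\le|f|$ and structure maps $\mu$, $\eta$ of seminorm $\le e$. An *enriched pullback* is a pullback square with projections $\pi_1,\pi_2$ such that $|h|=|\pi_1h|\vee|\pi_2h|$ and $d(h,k)=d(\pi_1h,\pi_1k)\vee d(\pi_2h,\pi_2k)$ for all $h,k$ into it. A *terminal object* $1$ receives exactly one morphism from each object, and that morphism has seminorm $\bot$. **Cartesian CLT-systems.** Let $\mathcal C$ be a pointwise additive monoidal dilated category, and $\mathcal D$ a monoidal dilated category whose monoidal structure is Cartesian, which has a terminal object and enriched pullbacks of all cospans of morphisms of seminorm $\le e$.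 Let $G,U:\mathcal C\to\mathcal D$ be lax monoidal dilated functors and $p:G\to U$ a natural transformation. Put $\theta^G_X=G(+_X)\circ\mu_{X,X}\circ\Delta_{GX}$, with $\Delta$ the Cartesian diagonal, similarly $\theta^U_X$, and $c=\bigvee_X|\theta^U_X|$. The triple $(G,U,p)$ is a *Cartesian CLT-system* if * each $p_X$ is an epimorphism with $|p_X|\le e$, and $p$ commutes with the lax monoidal maps $\mu$, with the morphisms $G(+_X)$, $U(+_X)$, and with the diagonals; * $[c,e]\le e$ and $[c,e]\star\theta^U_X=\mathrm{id}_{UX}$ for all $X$; * for every point $y:1\to UX$ and every enriched fibre $\iota:P\to GX$ of $p_X$ over $y$ (enriched pullback of $p_X$ and $y$), one has $d(a,b)<\top$ for all $a,b:1\to P$, and the endomorphism $\theta_y$ of $P$ with $\iota\circ\theta_y=([c,e]\star\theta^G_X)\circ\iota$ exists and satisfies $|\theta_y|<e$. **Observables.** Let $\mathcal A,\mathcal B$ be categories with finite products, and let $\mathcal C\hookrightarrow\mathcal A$ and $J:\mathcal D\hookrightarrow\mathcal B$ be faithful strong monoidal functors (inclusions of monoidal subcategories) for these products; let $F:\mathcal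 A\to\mathcal B$ be a functor restricting to the underlying functor of $G$. For $M\in\mathcal A$, the dilated category $\mathrm{Obs}(M,\mathcal C)$ has as objects the objects $(X,H:M\to X)$ of the comma category $M/\mathcal C$, and its hom-space from $(X,H)$ to $(Y,K)$ is the whole dilated space $\mathcal C(X,Y)$; the morphisms $\beta$ with $\beta\circ H=K$ form the comma category $M/\mathcal C$ itself. Its tensor product is $(X,H)\otimes(Y,K)=(X\otimes Y,(H,K))$, and all other structure, including addition, is that of $\mathcal C$. The same definitions apply to $\mathrm{Obs}(FM,\mathcal D)$. The projection to $\mathcal D$ is the *observation functor*. **Theorem.** Let $(G,U,p)$ be a Cartesian CLT-system as above, suppose that $J$ is continuous and cocontinuous, and let $M\in\mathcal A$. Consider the functors $\mathrm{Obs}(M,\mathcal C)\to\mathrm{Obs}(FM,\mathcal D)$ given by $(X,H)\mapsto(GX,FH)$ and $(X,H)\mapsto(UX,\,p_X\circ FH)$, acting on morphisms by $G$ and $U$, with the lax monoidal structures of $G$ and $U$, and the transformation between them with component $p_X$ at $(X,H)$. They form a Cartesian CLT-system. Moreover: 1. each of the conditions (N), (L), (R), if it holds in $\mathcal D$ (resp.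 $\mathcal C$), holds in $\mathrm{Obs}(FM,\mathcal D)$ (resp. $\mathrm{Obs}(M,\mathcal C)$); 2. both functors restrict to functors $M/\mathcal C\to FM/\mathcal D$, and the components $p_X$ of the transformation are morphisms of $FM/\mathcal D$; 3. the observation functor sends each enriched fibre of the transformation over a point to an enriched fibre of the corresponding $p_X$; 4. each cospan in $FM/\mathcal D$ of morphisms of seminorm $\le e$ has an enriched pullback in $\mathrm{Obs}(FM,\mathcal D)$ whose projections lie in $FM/\mathcal D$ and which is also a pullback in $FM/\mathcal D$. -/

import Mathlib

open CategoryTheory MonoidalCategory CartesianMonoidalCategory Limits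

universe w v₁ v₂ v₃ v₄ u₁ u₂ u₃ u₄

namespace DilatedCLT

/-! ### Quantale-valued distance spaces

Throughout, a (commutative, unital) quantale is a type `V` with
`[CompleteLattice V] [CommMonoid V] [IsQuantale V]`; its unit `e` is `1`. -/

section Spaces

variable {V : Type w} [CompleteLattice V] [CommMonoid V] [IsQuantale V]

/-- `y` is a limit point of the sequence `x` for the distance `d`. -/
def IsLimitPoint {A : Type*} (d : A → A → V) (x : ℕ → A) (y : A) : Prop :=
  ∀ r : V, ⊥ < r → ∃ N : ℕ, ∀ n, N ≤ n → d y (x n) ≤ r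

/-- Geometric sequences. -/
def IsGeometric {A : Type*} (d : A → A → V) (x : ℕ → A) : Prop :=
  ∃ r q : V, r < 1 ∧ q < ⊤ ∧
    (∀ i, d (x i) (x (i + 1)) ≤ r ^ i * q) ∧ ∀ i j, d (x i) (x j) < ⊤

/-- Every geometric sequence has a unique limit point `L`, and `L` satisfies
`d (x i) L ≤ ⨆ n, ⨅ j > n, d (x i) (x j)`. -/
def GeometricallyComplete {A : Type*} (d : A → A → V) : Prop :=
  ∀ x : ℕ → A, IsGeometric d x →
    ∃ L : A, IsLimitPoint d x L ∧ (∀ L', IsLimitPoint d x L' → L' = L) ∧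
      ∀ i, d (x i) L ≤ ⨆ n : ℕ, ⨅ j : ℕ, ⨅ _ : n < j, d (x i) (x j)

/-- Complete `V`-spaces. -/
structure IsCompleteSpace {A : Type*} (d : A → A → V) : Prop where
  dist_self : ∀ a, d a a ≤ ⊥
  dist_comm : ∀ a b, d a b = d b a
  complete : GeometricallyComplete d

variable (V) in
/-- The carrier of the unit interval monoid of the quantale. -/
def UnitInt : Type w := {q : V // q ≤ 1}

namespace UnitInt

/-- The unit `e` of the unit interval. -/
def one : UnitInt V := ⟨1, le_rfl⟩

/-- The bottom element of the unit interval. -/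
def bot : UnitInt V := ⟨⊥, bot_le⟩

/-- The multiplication of the unit interval. -/
def mul (q r : UnitInt V) : UnitInt V := ⟨q.1 * r.1, mul_le_one' q.2 r.2⟩

end UnitInt

end Spaces

/-- A unit interval dilated space: a choice of a complete distance on the unit interval for which
the multiplication is nonexpansive (for the maximum distance on the product). The seminorm is the
inclusion into `V` and the base point is `⊥`. -/
class UnitIntervalSpace (V : Type w) [CompleteLattice V] [CommMonoid V] [IsQuantale V] where
  /-- the distance -/
  d : UnitInt V → UnitInt V → V
  isComplete : IsCompleteSpace d
  mul_nonexpansive : ∀ q q' r r' : UnitInt V, d (q.mul q') (r.mul r') ≤ d q r ⊔ d q' r'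

/-- A dilated space: a complete `V`-space with a conical nonexpansive action of the unit interval
and a seminorm compatible with the action. -/
structure DilatedSpace (V : Type w) [CompleteLattice V] [CommMonoid V] [IsQuantale V]
    [UnitIntervalSpace V] (A : Type*) where
  /-- the distance -/
  d : A → A → V
  isComplete : IsCompleteSpace d
  /-- the action of the unit interval -/
  act : UnitInt V → A → A
  act_nonexpansive : ∀ q r a b, d (act q a) (act r b) ≤ UnitIntervalSpace.d q r ⊔ d a b
  one_act : ∀ a, act UnitInt.one a = a
  act_act : ∀ q r a, act q (act r a) = act (q.mul r) a
  /-- the base point -/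
  base : A
  bot_act : ∀ a, act UnitInt.bot a = base
  /-- the seminorm -/
  nrm : A → V
  nrm_act : ∀ q a, nrm (act q a) = q.1 * nrm a

/-! ### Dilated categories -/

/-- A dilated category: hom-sets are dilated spaces, identities have seminorm at most `e`, and
composition is submultiplicative for the seminorm and equivariant in each variable. The morphisms of
the underlying category are all elements of the hom-spaces. The metric conditions on composition are
separate predicates below: `CompositionNonexpansive`, which makes `C` a category
enriched in dilated spaces (a morphism of dilated spaces out of a tensor product being a map in two
variables that is equivariant in each of them, nonexpansive for the maximum distance, and
submultiplicative), and `LeftCompatible`, `RightCompatible`. -/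
class DilatedCategory (V : Type w) [CompleteLattice V] [CommMonoid V] [IsQuantale V]
    [UnitIntervalSpace V] (C : Type u₁) [Category.{v₁} C] where
  /-- the hom-spaces -/
  homSpace : ∀ X Y : C, DilatedSpace V (X ⟶ Y)
  nrm_id : ∀ X : C, (homSpace X X).nrm (𝟙 X) ≤ 1
  nrm_comp : ∀ {X Y Z : C} (f : X ⟶ Y) (g : Y ⟶ Z),
    (homSpace X Z).nrm (f ≫ g) ≤ (homSpace Y Z).nrm g * (homSpace X Y).nrm f
  act_comp : ∀ {X Y Z : C} (q : UnitInt V) (f : X ⟶ Y) (g : Y ⟶ Z),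
    (homSpace X Y).act q f ≫ g = (homSpace X Z).act q (f ≫ g)
  comp_act : ∀ {X Y Z : C} (q : UnitInt V) (f : X ⟶ Y) (g : Y ⟶ Z),
    f ≫ (homSpace Y Z).act q g = (homSpace X Z).act q (f ≫ g)

section Category

variable (V : Type w) [CompleteLattice V] [CommMonoid V] [IsQuantale V] [UnitIntervalSpace V]
variable {C : Type u₁} [Category.{v₁} C] [DilatedCategory V C]

/-- The seminorm `|f|` of a morphism. -/
def nrm {X Y : C} (f : X ⟶ Y) : V := (DilatedCategory.homSpace (V := V) X Y).nrm f

/-- The distance between parallel morphisms. -/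
def hdist {X Y : C} (f g : X ⟶ Y) : V := (DilatedCategory.homSpace (V := V) X Y).d f g

variable {V} in
/-- The dilation `q ⋆ f` of a morphism. -/
def dil {X Y : C} (q : UnitInt V) (f : X ⟶ Y) : X ⟶ Y :=
  (DilatedCategory.homSpace (V := V) X Y).act q f

variable (C) in
/-- Composition is nonexpansive for the maximum distance on pairs of morphisms. -/
def CompositionNonexpansive : Prop :=
  ∀ ⦃X Y Z : C⦄ (f f' : X ⟶ Y) (g g' : Y ⟶ Z),
    hdist V (f ≫ g) (f' ≫ g') ≤ hdist V g g' ⊔ hdist V f f'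

variable (C) in
/-- Left compatibility: composing after `f` is `|f|`-Lipschitz at finite distances. -/
def LeftCompatible : Prop :=
  ∀ ⦃X Y Z : C⦄ (f : Y ⟶ Z) (g₁ g₂ : X ⟶ Y), hdist V g₁ g₂ < ⊤ →
    hdist V (g₁ ≫ f) (g₂ ≫ f) ≤ nrm V f * hdist V g₁ g₂

variable (C) in
/-- Right compatibility: composing before `f` is `|f|`-Lipschitz at finite distances. -/
def RightCompatible : Prop :=
  ∀ ⦃X Y Z : C⦄ (f : X ⟶ Y) (g₁ g₂ : Y ⟶ Z), hdist V g₁ g₂ < ⊤ →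
    hdist V (f ≫ g₁) (f ≫ g₂) ≤ nrm V f * hdist V g₁ g₂

/-- A terminal object of a dilated category: every hom-space into it is a single point of
seminorm `⊥`. -/
def IsEnrichedTerminal (T : C) : Prop :=
  ∀ X : C, ∃ f : X ⟶ T, nrm V f = ⊥ ∧ ∀ g : X ⟶ T, g = f

/-- A conical (enriched) pullback square: for every `Q`, the hom-space `(Q ⟶ P)` is the pullback
of the hom-spaces, i.e. the set-theoretic pullback with the supremum distance and seminorm. -/
structure IsEnrichedPullback {P X Y Z : C} (fst : P ⟶ X) (snd : P ⟶ Y) (f : X ⟶ Z) (g : Y ⟶ Z) :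
    Prop where
  isPullback : IsPullback fst snd f g
  d_eq : ∀ {Q : C} (h k : Q ⟶ P),
    hdist V h k = hdist V (h ≫ fst) (k ≫ fst) ⊔ hdist V (h ≫ snd) (k ≫ snd)
  nrm_eq : ∀ {Q : C} (h : Q ⟶ P), nrm V h = nrm V (h ≫ fst) ⊔ nrm V (h ≫ snd)

variable (C) in
/-- Existence of enriched binary pullbacks; a conical diagram consists of morphisms of seminorm
at most `e`. -/
def HasEnrichedPullbacks : Prop :=
  ∀ ⦃X Y Z : C⦄ (f : X ⟶ Z) (g : Y ⟶ Z), nrm V f ≤ 1 → nrm V g ≤ 1 →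
    ∃ (P : C) (fst : P ⟶ X) (snd : P ⟶ Y), IsEnrichedPullback V fst snd f g

/-- Metrically small objects: any two generalised points are at distance `< ⊤`. -/
def MetricallySmall (X : C) : Prop :=
  ∀ ⦃T : C⦄, IsEnrichedTerminal V T → ∀ x y : T ⟶ X, hdist V x y < ⊤

variable (C) in
/-- Monoidal dilated categories: the structure isomorphisms have seminorm at most `e`. -/
structure IsMonoidalDilated [MonoidalCategory C] : Prop where
  associator_hom : ∀ X Y Z : C, nrm V (α_ X Y Z).hom ≤ 1
  associator_inv : ∀ X Y Z : C, nrm V (α_ X Y Z).inv ≤ 1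
  leftUnitor_hom : ∀ X : C, nrm V (λ_ X).hom ≤ 1
  leftUnitor_inv : ∀ X : C, nrm V (λ_ X).inv ≤ 1
  rightUnitor_hom : ∀ X : C, nrm V (ρ_ X).hom ≤ 1
  rightUnitor_inv : ∀ X : C, nrm V (ρ_ X).inv ≤ 1

end Category

/-- Pointwise addition: an arbitrary addition morphism on each object. -/
class PointwiseAdditive (C : Type u₁) [Category.{v₁} C] [MonoidalCategory C] where
  /-- the addition morphism -/
  add : ∀ X : C, X ⊗ X ⟶ X

/-! ### Gradings and CLT-systems -/

section Systems

variable {C : Type u₁} [Category.{v₁} C] [MonoidalCategory C]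
variable {D : Type u₂} [Category.{v₂} D]

/-- The functor `X ↦ F X ⊗ F X`. -/
@[simps]
def tensorSquare [MonoidalCategory D] (F : C ⥤ D) : C ⥤ D where
  obj X := F.obj X ⊗ F.obj X
  map f := F.map f ⊗ₘ F.map f

/-- The Cartesian diagonal `F ⟶ F ⊗ F` for a Cartesian monoidal target. -/
@[simps]
def cartesianDiagonal [CartesianMonoidalCategory D] (F : C ⥤ D) : F ⟶ tensorSquare F where
  app X := lift (𝟙 (F.obj X)) (𝟙 (F.obj X))
  naturality X Y f := by
    change F.map f ≫ lift (𝟙 (F.obj Y)) (𝟙 (F.obj Y)) =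
      lift (𝟙 (F.obj X)) (𝟙 (F.obj X)) ≫ (F.map f ⊗ₘ F.map f)
    rw [comp_lift, lift_map, Category.comp_id, Category.id_comp]

/-- The convolution operator `F X ⟶ F X ⊗ F X ⟶ F (X ⊗ X) ⟶ F X`. -/
def convolution [PointwiseAdditive C] [MonoidalCategory D] (F : C ⥤ D) [F.LaxMonoidal]
    (Δ : F ⟶ tensorSquare F) (X : C) : F.obj X ⟶ F.obj X :=
  Δ.app X ≫ Functor.LaxMonoidal.μ F X X ≫ F.map (PointwiseAdditive.add X)

variable (V : Type w) [CompleteLattice V] [CommMonoid V] [IsQuantale V] [UnitIntervalSpace V]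
variable [DilatedCategory V C] [DilatedCategory V D]

/-- Lax monoidal dilated functors. -/
structure IsLaxMonoidalDilated [MonoidalCategory D] (F : C ⥤ D) [F.LaxMonoidal] : Prop where
  nrm_map : ∀ {X Y : C} (f : X ⟶ Y), nrm V (F.map f) ≤ nrm V f
  nrm_ε : nrm V (Functor.LaxMonoidal.ε F) ≤ 1
  nrm_μ : ∀ X Y : C, nrm V (Functor.LaxMonoidal.μ F X Y) ≤ 1

/-- The grading constant `c` of `G`: the common value of the seminorms of the convolution operators
`θ X : G X ⟶ G X`, taken as their supremum, so that objects with `|θ X| = ⊥` (such as those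
sent to a zero object) do not matter. -/
def gradingConstant [PointwiseAdditive C] [MonoidalCategory D] (G : C ⥤ D) [G.LaxMonoidal]
    (Δ : G ⟶ tensorSquare G) : V :=
  ⨆ X : C, nrm V (convolution G Δ X)

/-- The element `[c, e]` of the quantale for the grading constant `c`. -/
def rescaling [PointwiseAdditive C] [MonoidalCategory D] (G : C ⥤ D) [G.LaxMonoidal]
    (Δ : G ⟶ tensorSquare G) : V :=
  Quantale.rightMulResiduation (gradingConstant V G Δ) 1

/-- `G` is perfectly rescalable: `[c, e]` lies in the unit interval, and `[c, e] ⋆ θ X = 𝟙`. -/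
def PerfectlyRescalable [PointwiseAdditive C] [MonoidalCategory D] (G : C ⥤ D) [G.LaxMonoidal]
    (Δ : G ⟶ tensorSquare G) : Prop :=
  ∃ h : rescaling V G Δ ≤ 1, ∀ X : C,
    dil (⟨rescaling V G Δ, h⟩ : UnitInt V) (convolution G Δ X) = 𝟙 (G.obj X)

/-- `p` is a grading of `F` with respect to `G`. -/
structure IsGrading [PointwiseAdditive C] [MonoidalCategory D] (F G : C ⥤ D) [F.LaxMonoidal]
    [G.LaxMonoidal] (p : F ⟶ G) : Prop where
  tensor_comm : ∀ X Y : C,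
    Functor.LaxMonoidal.μ F X Y ≫ p.app (X ⊗ Y) =
      (p.app X ⊗ₘ p.app Y) ≫ Functor.LaxMonoidal.μ G X Y
  add_comm : ∀ X : C,
    F.map (PointwiseAdditive.add X) ≫ p.app X =
      p.app (X ⊗ X) ≫ G.map (PointwiseAdditive.add X)
  epi : ∀ X : C, Epi (p.app X)
  nrm_le : ∀ X : C, nrm V (p.app X) ≤ 1

/-- Pre-CLT systems, including the standing assumptions on `C`, `D`, `F`, `G`. The field
`diagonal_comm` is the compatibility of the two diagonals with the grading. -/
structure IsPreCLTSystem [PointwiseAdditive C] [MonoidalCategory D] (F G : C ⥤ D)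
    [F.LaxMonoidal] [G.LaxMonoidal] (p : F ⟶ G)
    (ΔF : F ⟶ tensorSquare F) (ΔG : G ⟶ tensorSquare G) : Prop where
  source_monoidal : IsMonoidalDilated V C
  target_monoidal : IsMonoidalDilated V D
  target_terminal : ∃ T : D, IsEnrichedTerminal V T
  target_pullbacks : HasEnrichedPullbacks V D
  lax_F : IsLaxMonoidalDilated V F
  lax_G : IsLaxMonoidalDilated V G
  grading : IsGrading V F G p
  rescalable : PerfectlyRescalable V G ΔG
  diagonal_comm : ∀ X : C, ΔF.app X ≫ (p.app X ⊗ₘ p.app X) = p.app X ≫ ΔG.app X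

/-- CLT-systems: every fibre `P` of `p.app X` over a generalised point `y` is metrically small, and
the endomorphism `θ` of `P` induced by `[c, e] ⋆ convolution F ΔF X`, where `c` is the grading
constant of `G`, has seminorm `< e`. -/
structure IsCLTSystem [PointwiseAdditive C] [MonoidalCategory D] (F G : C ⥤ D)
    [F.LaxMonoidal] [G.LaxMonoidal] (p : F ⟶ G)
    (ΔF : F ⟶ tensorSquare F) (ΔG : G ⟶ tensorSquare G) : Prop
    extends IsPreCLTSystem V F G p ΔF ΔG where
  fibre_small : ∀ (X : C) {T : D}, IsEnrichedTerminal V T → ∀ (y : T ⟶ G.obj X)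
    {P : D} (ι : P ⟶ F.obj X) (t : P ⟶ T), IsEnrichedPullback V ι t (p.app X) y →
      MetricallySmall V P
  fibre_contractive : ∀ (X : C) {T : D}, IsEnrichedTerminal V T → ∀ (y : T ⟶ G.obj X)
    {P : D} (ι : P ⟶ F.obj X) (t : P ⟶ T), IsEnrichedPullback V ι t (p.app X) y →
      ∃ (h : rescaling V G ΔG ≤ 1) (θ : P ⟶ P),
        θ ≫ ι = ι ≫ dil (⟨rescaling V G ΔG, h⟩ : UnitInt V) (convolution F ΔF X) ∧
          nrm V θ < 1

/-- Cartesian CLT-systems: `D` is Cartesian monoidal and the diagonals are the Cartesian ones. -/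
def IsCartesianCLTSystem [PointwiseAdditive C] [CartesianMonoidalCategory D] (F G : C ⥤ D)
    [F.LaxMonoidal] [G.LaxMonoidal] (p : F ⟶ G) : Prop :=
  IsCLTSystem V F G p (cartesianDiagonal F) (cartesianDiagonal G)

end Systems

/-! ### The category of observables -/

/-- An observable on `M`: an object `obj` of `D` with a morphism `obs` from `M`, for an inclusion
`J : D ⥤ B`; that is, an object of the comma category `M / D`. -/
structure Obs {B : Type u₁} [Category.{v₁} B] {D : Type u₂} [Category.{v₂} D] (J : D ⥤ B)
    (M : B) where
  /-- the object of values -/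
  obj : D
  /-- the observable -/
  obs : M ⟶ J.obj obj

namespace Obs

section Basic

variable {B : Type u₁} [Category.{v₁} B] {D : Type u₂} [Category.{v₂} D] {J : D ⥤ B} {M : B}

/-- The hom-space between two observables is the whole hom-space of `D`. -/
instance : Category.{v₂} (Obs J M) where
  Hom X Y := X.obj ⟶ Y.obj
  id X := 𝟙 X.obj
  comp f g := CategoryStruct.comp (obj := D) f g
  id_comp f := Category.id_comp (obj := D) f
  comp_id f := Category.comp_id (obj := D) f
  assoc f g h := Category.assoc (obj := D) f g h

/-- The observation functor. -/
def push (J : D ⥤ B) (M : B) : Obs J M ⥤ D where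
  obj X := X.obj
  map f := f

/-- A morphism of `Obs J M` is a morphism of the comma category `M / D` if it makes the triangle
under `M` commute. -/
def IsCommaMorphism {X Y : Obs J M} (f : X ⟶ Y) : Prop :=
  X.obs ≫ J.map ((push J M).map f) = Y.obs

instance (V : Type w) [CompleteLattice V] [CommMonoid V] [IsQuantale V] [UnitIntervalSpace V]
    [DilatedCategory V D] : DilatedCategory V (Obs J M) where
  homSpace X Y := DilatedCategory.homSpace (V := V) X.obj Y.obj
  nrm_id X := DilatedCategory.nrm_id (V := V) X.obj
  nrm_comp f g := DilatedCategory.nrm_comp (V := V) (C := D) f g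
  act_comp q f g := DilatedCategory.act_comp (V := V) (C := D) q f g
  comp_act q f g := DilatedCategory.comp_act (V := V) (C := D) q f g

end Basic

section Monoidal

variable {B : Type u₁} [Category.{v₁} B] [CartesianMonoidalCategory B]
variable {D : Type u₂} [Category.{v₂} D]

/-- An isomorphism of `D` as an isomorphism of observables. -/
def isoMk {J : D ⥤ B} {M : B} {X Y : Obs J M} (e : X.obj ≅ Y.obj) : X ≅ Y where
  hom := e.hom
  inv := e.inv
  hom_inv_id := e.hom_inv_id
  inv_hom_id := e.inv_hom_id

/-- The tensor product of `(V, H)` and `(W, K)` is `V ⊗ W` with the observable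
`M ⟶ V ⊗ W` with components `H`, `K`; on morphisms, and for the structure isomorphisms, it is the
one of `D`. -/
instance [MonoidalCategory D] (J : D ⥤ B) [J.Monoidal] (M : B) :
    MonoidalCategory (Obs J M) where
  tensorObj X Y := ⟨X.obj ⊗ Y.obj, lift X.obs Y.obs ≫ Functor.LaxMonoidal.μ J X.obj Y.obj⟩
  whiskerLeft X _ _ f := X.obj ◁ ((push J M).map f)
  whiskerRight f Y := ((push J M).map f) ▷ Y.obj
  tensorHom f g := (push J M).map f ⊗ₘ (push J M).map g
  tensorUnit := ⟨𝟙_ D, toUnit M ≫ Functor.LaxMonoidal.ε J⟩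
  associator X Y Z := isoMk (α_ X.obj Y.obj Z.obj)
  leftUnitor X := isoMk (λ_ X.obj)
  rightUnitor X := isoMk (ρ_ X.obj)
  tensorHom_def _ _ := MonoidalCategory.tensorHom_def (C := D) _ _
  id_tensorHom_id _ _ := MonoidalCategory.id_tensorHom_id (C := D) _ _
  tensorHom_comp_tensorHom _ _ _ _ :=
    MonoidalCategory.tensorHom_comp_tensorHom (C := D) _ _ _ _
  whiskerLeft_id _ _ := MonoidalCategory.whiskerLeft_id (C := D) _ _
  id_whiskerRight _ _ := MonoidalCategory.id_whiskerRight (C := D) _ _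
  associator_naturality _ _ _ := MonoidalCategory.associator_naturality (C := D) _ _ _
  leftUnitor_naturality _ := MonoidalCategory.leftUnitor_naturality (C := D) _
  rightUnitor_naturality _ := MonoidalCategory.rightUnitor_naturality (C := D) _
  pentagon _ _ _ _ := MonoidalCategory.pentagon (C := D) _ _ _ _
  triangle _ _ := MonoidalCategory.triangle (C := D) _ _

instance [MonoidalCategory D] [PointwiseAdditive D] (J : D ⥤ B) [J.Monoidal] (M : B) :
    PointwiseAdditive (Obs J M) where
  add X := PointwiseAdditive.add X.obj

/-- If `D` is Cartesian monoidal, then so is the category of observables. -/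
instance [CartesianMonoidalCategory D] (J : D ⥤ B) [J.Monoidal] (M : B) :
    CartesianMonoidalCategory (Obs J M) where
  isTerminalTensorUnit := IsTerminal.ofUniqueHom (fun X => toUnit X.obj)
    (fun _ _ => toUnit_unique (C := D) _ _)
  fst X Y := fst X.obj Y.obj
  snd X Y := snd X.obj Y.obj
  tensorProductIsBinaryProduct _ _ := BinaryFan.IsLimit.mk _
    (fun f g => lift ((push J M).map f) ((push J M).map g))
    (fun _ _ => lift_fst (C := D) _ _)
    (fun _ _ => lift_snd (C := D) _ _)
    (fun _ _ _ h₁ h₂ => hom_ext (C := D) _ _ (h₁.trans (lift_fst (C := D) _ _).symm)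
      (h₂.trans (lift_snd (C := D) _ _).symm))
  fst_def X Y := SemiCartesianMonoidalCategory.fst_def (C := D) X.obj Y.obj
  snd_def X Y := SemiCartesianMonoidalCategory.snd_def (C := D) X.obj Y.obj

end Monoidal

section Functors

variable {A : Type u₁} [Category.{v₁} A] {B : Type u₂} [Category.{v₂} B]
variable {C : Type u₃} [Category.{v₃} C] {D : Type u₄} [Category.{v₄} D]
variable {JC : C ⥤ A} {JD : D ⥤ B}

/-- The functor `(V, H) ↦ (K V, F M ⟶ F (JC V) ⟶ JD (K V))` induced by `K` and
`a : JC ⋙ F ⟶ K ⋙ JD`. -/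
def induced (F : A ⥤ B) (K : C ⥤ D) (a : JC ⋙ F ⟶ K ⋙ JD) (M : A) :
    Obs JC M ⥤ Obs JD (F.obj M) where
  obj X := ⟨K.obj X.obj, F.map X.obs ≫ a.app X.obj⟩
  map f := K.map ((push JC M).map f)
  map_id X := K.map_id X.obj
  map_comp f g := K.map_comp ((push JC M).map f) ((push JC M).map g)

instance [CartesianMonoidalCategory A] [CartesianMonoidalCategory B]
    [MonoidalCategory C] [MonoidalCategory D] [JC.Monoidal] [JD.Monoidal]
    (F : A ⥤ B) (K : C ⥤ D) [K.LaxMonoidal] (a : JC ⋙ F ⟶ K ⋙ JD) (M : A) :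
    (induced F K a M).LaxMonoidal where
  ε := Functor.LaxMonoidal.ε K
  μ X Y := Functor.LaxMonoidal.μ K X.obj Y.obj
  μ_natural_left f X := Functor.LaxMonoidal.μ_natural_left K ((push JC M).map f) X.obj
  μ_natural_right X f := Functor.LaxMonoidal.μ_natural_right K X.obj ((push JC M).map f)
  associativity X Y Z := Functor.LaxMonoidal.associativity K X.obj Y.obj Z.obj
  left_unitality X := Functor.LaxMonoidal.left_unitality K X.obj
  right_unitality X := Functor.LaxMonoidal.right_unitality K X.obj

/-- The functor of observables `(V, H) ↦ (G V, F H)` of an internal dilated functor `(F, G)`,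
where `φ` says that `G` is the restriction of `F`. -/
def functor (F : A ⥤ B) (G : C ⥤ D) (φ : JC ⋙ F ≅ G ⋙ JD) (M : A) :
    Obs JC M ⥤ Obs JD (F.obj M) :=
  induced F G φ.hom M

/-- The functor of observables `(V, H) ↦ (U V, F M ⟶ G V ⟶ U V)`, with second map `p`. -/
def gradedFunctor (F : A ⥤ B) (G U : C ⥤ D) (φ : JC ⋙ F ≅ G ⋙ JD) (p : G ⟶ U) (M : A) :
    Obs JC M ⥤ Obs JD (F.obj M) :=
  induced F U (φ.hom ≫ Functor.whiskerRight p JD) M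

/-- The grading of observables, with components those of `p`. -/
def grading (F : A ⥤ B) (G U : C ⥤ D) (φ : JC ⋙ F ≅ G ⋙ JD) (p : G ⟶ U) (M : A) :
    functor F G φ M ⟶ gradedFunctor F G U φ p M where
  app X := p.app X.obj
  naturality _ _ f := p.naturality ((push JC M).map f)

section

variable [CartesianMonoidalCategory A] [CartesianMonoidalCategory B]
  [MonoidalCategory C] [MonoidalCategory D] [JC.Monoidal] [JD.Monoidal]
  (F : A ⥤ B) (G U : C ⥤ D) [G.LaxMonoidal] [U.LaxMonoidal] (φ : JC ⋙ F ≅ G ⋙ JD) (p : G ⟶ U)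
  (M : A)

instance : (functor F G φ M).LaxMonoidal :=
  inferInstanceAs (induced F G φ.hom M).LaxMonoidal

instance : (gradedFunctor F G U φ p M).LaxMonoidal :=
  inferInstanceAs (induced F U (φ.hom ≫ Functor.whiskerRight p JD) M).LaxMonoidal

end

end Functors

end Obs

end DilatedCLT

open DilatedCLT

/-!
The category of observables has the same morphisms as `D`, so everything reduces to knowing which
objects of `D` carry an observable, and all of them do: the hom-spaces of `D` have base points, so
there is a morphism from the monoidal unit to every object `X`, and `M ⟶ 1 ⟶ J 1 ⟶ J X` is an
observable with values in `X` (`Obs.ofObj`). Hence the observation functor `Obs.push` is an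
equivalence of categories (`Obs.isEquivalence_push`), and it preserves distances and seminorms on
the nose.

Consequently enriched terminal objects and enriched pullbacks of observables are exactly those of
`D` (`Obs.isEnrichedTerminal_push_iff`, `Obs.isEnrichedPullback_push_iff`), and the rescaling
constant, which depends on a supremum over all objects, is the same for observables as for the
original functor (`Obs.rescaling_induced`). The axioms of a CLT-system for observables are then those
of the given system.

For pullbacks in the comma category, the inclusion `J` preserves the pullback in `D`, so the
observables of the two feet of the cospan induce an observable on the pullback
(`Obs.exists_isEnrichedPullback_isCommaMorphism`).
-/

namespace DilatedCLT

namespace Obs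

section Push

variable (V : Type w) [CompleteLattice V] [CommMonoid V] [IsQuantale V] [UnitIntervalSpace V]
variable {B : Type u₁} [Category.{v₁} B] {D : Type u₂} [Category.{v₂} D] {J : D ⥤ B} {M : B}

instance : (push J M).Faithful where
  map_injective h := h

instance : (push J M).Full where
  map_surjective f := ⟨f, rfl⟩

/-- The observable on `M` with values in `X` that factors through the monoidal unit, by the base
point of the hom-space `𝟙_ D ⟶ X`. -/
def ofObj [CartesianMonoidalCategory B] [MonoidalCategory D] [DilatedCategory V D]
    (J : D ⥤ B) [J.Monoidal] (M : B) (X : D) : Obs J M where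
  obj := X
  obs := toUnit M ≫ Functor.LaxMonoidal.ε J ≫
    J.map (DilatedCategory.homSpace (V := V) (𝟙_ D) X).base

/-- Every object is the value of some observable, because hom-spaces are inhabited. -/
theorem isEquivalence_push [CartesianMonoidalCategory B] [MonoidalCategory D]
    [DilatedCategory V D] [J.Monoidal] : (push J M).IsEquivalence where
  essSurj := ⟨fun X => ⟨ofObj V J M X, ⟨Iso.refl X⟩⟩⟩

theorem isEnrichedTerminal_push_iff [CartesianMonoidalCategory B] [MonoidalCategory D]
    [DilatedCategory V D] [J.Monoidal] {T : Obs J M} :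
    IsEnrichedTerminal V ((push J M).obj T) ↔ IsEnrichedTerminal V T :=
  ⟨fun h X => h X.obj, fun h X => h (ofObj V J M X)⟩

theorem isEnrichedPullback_push_iff [CartesianMonoidalCategory B] [MonoidalCategory D]
    [DilatedCategory V D] [J.Monoidal] {P X Y Z : Obs J M} {fst : P ⟶ X} {snd : P ⟶ Y}
    {f : X ⟶ Z} {g : Y ⟶ Z} :
    IsEnrichedPullback V ((push J M).map fst) ((push J M).map snd) ((push J M).map f)
      ((push J M).map g) ↔ IsEnrichedPullback V fst snd f g := by
  have := isEquivalence_push V (J := J) (M := M)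
  exact
    ⟨fun h => ⟨(IsPullback.map_iff (push J M) h.isPullback.w).1 h.isPullback,
      fun {Q} => h.d_eq (Q := Q.obj), fun {Q} => h.nrm_eq (Q := Q.obj)⟩,
    fun h => ⟨h.isPullback.map (push J M),
      fun {Q} => h.d_eq (Q := ofObj V J M Q), fun {Q} => h.nrm_eq (Q := ofObj V J M Q)⟩⟩

theorem isMonoidalDilated [CartesianMonoidalCategory B] [MonoidalCategory D]
    [DilatedCategory V D] [J.Monoidal] (h : IsMonoidalDilated V D) :
    IsMonoidalDilated V (Obs J M) where
  associator_hom X Y Z := h.associator_hom X.obj Y.obj Z.obj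
  associator_inv X Y Z := h.associator_inv X.obj Y.obj Z.obj
  leftUnitor_hom X := h.leftUnitor_hom X.obj
  leftUnitor_inv X := h.leftUnitor_inv X.obj
  rightUnitor_hom X := h.rightUnitor_hom X.obj
  rightUnitor_inv X := h.rightUnitor_inv X.obj

theorem hasEnrichedPullbacks [CartesianMonoidalCategory B] [MonoidalCategory D]
    [DilatedCategory V D] [J.Monoidal] (h : HasEnrichedPullbacks V D) :
    HasEnrichedPullbacks V (Obs J M) := fun X Y Z f g hf hg => by
  obtain ⟨P, fst, snd, hP⟩ := h ((push J M).map f) ((push J M).map g) hf hg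
  exact ⟨ofObj V J M P, fst, snd, (isEnrichedPullback_push_iff V).1 hP⟩

/-- The observables of the feet of a cospan of comma morphisms agree in the apex, so they induce an
observable on the pullback; the universal property in `B` makes it a pullback of the comma
category. -/
theorem exists_isEnrichedPullback_isCommaMorphism [CartesianMonoidalCategory B]
    [MonoidalCategory D] [DilatedCategory V D] [J.Monoidal] [PreservesLimitsOfShape WalkingCospan J]
    (hD : HasEnrichedPullbacks V D) {X Y Z : Obs J M} (f : X ⟶ Z) (g : Y ⟶ Z)
    (hf : IsCommaMorphism f) (hg : IsCommaMorphism g) (hf₁ : nrm V f ≤ 1) (hg₁ : nrm V g ≤ 1) :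
    ∃ (P : Obs J M) (fst : P ⟶ X) (snd : P ⟶ Y), IsEnrichedPullback V fst snd f g ∧
      IsCommaMorphism fst ∧ IsCommaMorphism snd ∧
      ∀ ⦃Q : Obs J M⦄ (k : Q ⟶ P), IsCommaMorphism (k ≫ fst) → IsCommaMorphism (k ≫ snd) →
        IsCommaMorphism k := by
  obtain ⟨P, fst, snd, hP⟩ := hD ((push J M).map f) ((push J M).map g) hf₁ hg₁
  have hJ := hP.isPullback.map J
  have w : X.obs ≫ J.map ((push J M).map f) = Y.obs ≫ J.map ((push J M).map g) :=
    hf.trans hg.symm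
  let P' : Obs J M := ⟨P, hJ.lift X.obs Y.obs w⟩
  let fst' : P' ⟶ X := fst
  let snd' : P' ⟶ Y := snd
  have h₁ : IsCommaMorphism fst' := hJ.lift_fst _ _ w
  have h₂ : IsCommaMorphism snd' := hJ.lift_snd _ _ w
  refine ⟨P', fst', snd', (isEnrichedPullback_push_iff V).1 hP, h₁, h₂, fun Q k hk₁ hk₂ => ?_⟩
  let k' : Q.obj ⟶ P := k
  have e₁ : Q.obs ≫ J.map (k' ≫ fst) = X.obs := hk₁
  have e₂ : Q.obs ≫ J.map (k' ≫ snd) = Y.obs := hk₂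
  rw [Functor.map_comp, ← Category.assoc] at e₁ e₂
  exact hJ.hom_ext (e₁.trans h₁.symm) (e₂.trans h₂.symm)

end Push

section Functors

variable {V : Type w} [CompleteLattice V] [CommMonoid V] [IsQuantale V] [UnitIntervalSpace V]
variable {A : Type u₁} [Category.{v₁} A] [CartesianMonoidalCategory A]
variable {B : Type u₂} [Category.{v₂} B] [CartesianMonoidalCategory B]
variable {C : Type u₃} [Category.{v₃} C] [MonoidalCategory C]
variable {D : Type u₄} [Category.{v₄} D] [CartesianMonoidalCategory D] [DilatedCategory V D]
variable {JC : C ⥤ A} [JC.Monoidal] {JD : D ⥤ B} [JD.Monoidal]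

theorem isGrading_grading [PointwiseAdditive C] (F : A ⥤ B) {G U : C ⥤ D} [G.LaxMonoidal]
    [U.LaxMonoidal] (φ : JC ⋙ F ≅ G ⋙ JD) {p : G ⟶ U} (M : A) (h : IsGrading V G U p) :
    IsGrading V (functor F G φ M) (gradedFunctor F G U φ p M) (grading F G U φ p M) where
  tensor_comm X Y := h.tensor_comm X.obj Y.obj
  add_comm X := h.add_comm X.obj
  epi X := (push JD (F.obj M)).epi_of_epi_map (h.epi X.obj)
  nrm_le X := h.nrm_le X.obj

variable [DilatedCategory V C]

theorem isLaxMonoidalDilated_induced (F : A ⥤ B) {K : C ⥤ D} [K.LaxMonoidal]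
    (a : JC ⋙ F ⟶ K ⋙ JD) (M : A) (h : IsLaxMonoidalDilated V K) :
    IsLaxMonoidalDilated V (induced F K a M) where
  nrm_map f := h.nrm_map ((push JC M).map f)
  nrm_ε := h.nrm_ε
  nrm_μ X Y := h.nrm_μ X.obj Y.obj

/-- The supremum defining the grading constant runs over all objects of `C` in both cases, since
each of them is the value of an observable. -/
theorem rescaling_induced [PointwiseAdditive C] (F : A ⥤ B) (K : C ⥤ D) [K.LaxMonoidal]
    (a : JC ⋙ F ⟶ K ⋙ JD) (M : A) :
    rescaling V (induced F K a M) (cartesianDiagonal (induced F K a M)) =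
      rescaling V K (cartesianDiagonal K) := by
  have h : gradingConstant V (induced F K a M) (cartesianDiagonal (induced F K a M)) =
      gradingConstant V K (cartesianDiagonal K) :=
    Function.Surjective.iSup_congr (fun X : Obs JC M => X.obj)
      (fun X => ⟨ofObj V JC M X, rfl⟩) fun _ => rfl
  rw [rescaling, rescaling, h]

theorem perfectlyRescalable_induced [PointwiseAdditive C] (F : A ⥤ B) {K : C ⥤ D}
    [K.LaxMonoidal] (a : JC ⋙ F ⟶ K ⋙ JD) (M : A)
    (h : PerfectlyRescalable V K (cartesianDiagonal K)) :
    PerfectlyRescalable V (induced F K a M) (cartesianDiagonal (induced F K a M)) := by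
  unfold PerfectlyRescalable at h ⊢
  rw [rescaling_induced]
  obtain ⟨hle, h⟩ := h
  exact ⟨hle, fun X => h X.obj⟩

theorem isCartesianCLTSystem_grading [PointwiseAdditive C] (F : A ⥤ B) {G U : C ⥤ D}
    [G.LaxMonoidal] [U.LaxMonoidal] (φ : JC ⋙ F ≅ G ⋙ JD) {p : G ⟶ U} (M : A)
    (h : IsCartesianCLTSystem V G U p) :
    IsCartesianCLTSystem V (functor F G φ M) (gradedFunctor F G U φ p M)
      (grading F G U φ p M) where
  source_monoidal := isMonoidalDilated V h.source_monoidal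
  target_monoidal := isMonoidalDilated V h.target_monoidal
  target_terminal :=
    let ⟨T, hT⟩ := h.target_terminal
    ⟨ofObj V JD (F.obj M) T, (isEnrichedTerminal_push_iff V).1 hT⟩
  target_pullbacks := hasEnrichedPullbacks V h.target_pullbacks
  lax_F := isLaxMonoidalDilated_induced F φ.hom M h.lax_F
  lax_G := isLaxMonoidalDilated_induced F (φ.hom ≫ Functor.whiskerRight p JD) M h.lax_G
  grading := isGrading_grading F φ M h.grading
  rescalable :=
    perfectlyRescalable_induced F (φ.hom ≫ Functor.whiskerRight p JD) M h.rescalable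
  diagonal_comm X := h.diagonal_comm X.obj
  fibre_small X _ hT y _ ι t hP _ hT' :=
    h.fibre_small X.obj ((isEnrichedTerminal_push_iff V).2 hT) ((push JD (F.obj M)).map y)
      ((push JD (F.obj M)).map ι) ((push JD (F.obj M)).map t)
      ((isEnrichedPullback_push_iff V).2 hP) ((isEnrichedTerminal_push_iff V).2 hT')
  fibre_contractive X T hT y P ι t hP := by
    have e : rescaling V (gradedFunctor F G U φ p M)
        (cartesianDiagonal (gradedFunctor F G U φ p M)) = rescaling V U (cartesianDiagonal U) :=
      rescaling_induced F U (φ.hom ≫ Functor.whiskerRight p JD) M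
    rw [e]
    exact h.fibre_contractive X.obj ((isEnrichedTerminal_push_iff V).2 hT)
      ((push JD (F.obj M)).map y) ((push JD (F.obj M)).map ι) ((push JD (F.obj M)).map t)
      ((isEnrichedPullback_push_iff V).2 hP)

end Functors

section Comma

variable {A : Type u₁} [Category.{v₁} A] {B : Type u₂} [Category.{v₂} B]
variable {C : Type u₃} [Category.{v₃} C] {D : Type u₄} [Category.{v₄} D]
variable {JC : C ⥤ A} {JD : D ⥤ B}

theorem IsCommaMorphism.induced_map (F : A ⥤ B) {K : C ⥤ D} (a : JC ⋙ F ⟶ K ⋙ JD) {M : A}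
    {X Y : Obs JC M} {f : X ⟶ Y} (hf : IsCommaMorphism f) :
    IsCommaMorphism ((induced F K a M).map f) := by
  let f' : X.obj ⟶ Y.obj := f
  have hf' : X.obs ≫ JC.map f' = Y.obs := hf
  change (F.map X.obs ≫ a.app X.obj) ≫ JD.map (K.map f') = F.map Y.obs ≫ a.app Y.obj
  rw [← hf', Functor.map_comp, Category.assoc, Category.assoc]
  exact congrArg (F.map X.obs ≫ ·) (a.naturality f').symm

theorem isCommaMorphism_grading_app (F : A ⥤ B) {G U : C ⥤ D} (φ : JC ⋙ F ≅ G ⋙ JD)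
    (p : G ⟶ U) {M : A} (X : Obs JC M) :
    IsCommaMorphism ((grading F G U φ p M).app X) :=
  Category.assoc (F.map X.obs) (φ.hom.app X.obj) (JD.map (p.app X.obj))

end Comma

end Obs

end DilatedCLT

theorem mainTheorem3
    {V : Type w} [CompleteLattice V] [CommMonoid V] [IsQuantale V] [UnitIntervalSpace V]
    {A : Type u₁} [Category.{v₁} A] [CartesianMonoidalCategory A]
    {B : Type u₂} [Category.{v₂} B] [CartesianMonoidalCategory B]
    {C : Type u₃} [Category.{v₃} C] [MonoidalCategory C] [DilatedCategory V C]
    [PointwiseAdditive C]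
    {D : Type u₄} [Category.{v₄} D] [CartesianMonoidalCategory D] [DilatedCategory V D]
    (JC : C ⥤ A) [JC.Faithful] [JC.Monoidal]
    (JD : D ⥤ B) [JD.Faithful] [JD.Monoidal] [PreservesLimits JD] [PreservesColimits JD]
    (F : A ⥤ B) (G U : C ⥤ D) [G.LaxMonoidal] [U.LaxMonoidal]
    (φ : JC ⋙ F ≅ G ⋙ JD) (p : G ⟶ U)
    (hCLT : IsCartesianCLTSystem V G U p) (M : A) :
    -- the tuple on the categories of observables is a Cartesian CLT-system
    IsCartesianCLTSystem V (Obs.functor F G φ M) (Obs.gradedFunctor F G U φ p M)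
      (Obs.grading F G U φ p M) ∧
    -- the metric conditions on composition are inherited by the category of observables
    (CompositionNonexpansive V D → CompositionNonexpansive V (Obs JD (F.obj M))) ∧
    (CompositionNonexpansive V C → CompositionNonexpansive V (Obs JC M)) ∧
    (LeftCompatible V D → LeftCompatible V (Obs JD (F.obj M))) ∧
    (LeftCompatible V C → LeftCompatible V (Obs JC M)) ∧
    (RightCompatible V D → RightCompatible V (Obs JD (F.obj M))) ∧
    (RightCompatible V C → RightCompatible V (Obs JC M)) ∧
    -- both functors and the grading restrict to the comma categories
    (∀ ⦃X Y : Obs JC M⦄ (f : X ⟶ Y), Obs.IsCommaMorphism f →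
      Obs.IsCommaMorphism ((Obs.functor F G φ M).map f) ∧
      Obs.IsCommaMorphism ((Obs.gradedFunctor F G U φ p M).map f)) ∧
    (∀ X : Obs JC M, Obs.IsCommaMorphism ((Obs.grading F G U φ p M).app X)) ∧
    -- the observation functor preserves enriched fibres of the grading
    (∀ (X : Obs JC M) ⦃T P : Obs JD (F.obj M)⦄ (y : T ⟶ (Obs.gradedFunctor F G U φ p M).obj X)
      (ι : P ⟶ (Obs.functor F G φ M).obj X) (t : P ⟶ T),
      IsEnrichedPullback V ι t ((Obs.grading F G U φ p M).app X) y →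
      IsEnrichedPullback V ((Obs.push JD (F.obj M)).map ι) ((Obs.push JD (F.obj M)).map t)
        (p.app X.obj) ((Obs.push JD (F.obj M)).map y)) ∧
    -- a pullback of morphisms of the comma category can be computed in the comma category
    (∀ ⦃X Y Z : Obs JD (F.obj M)⦄ (f : X ⟶ Z) (g : Y ⟶ Z),
      Obs.IsCommaMorphism f → Obs.IsCommaMorphism g → nrm V f ≤ 1 → nrm V g ≤ 1 →
      ∃ (P : Obs JD (F.obj M)) (fst : P ⟶ X) (snd : P ⟶ Y),
        IsEnrichedPullback V fst snd f g ∧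
        Obs.IsCommaMorphism fst ∧ Obs.IsCommaMorphism snd ∧
        ∀ ⦃Q : Obs JD (F.obj M)⦄ (k : Q ⟶ P),
          Obs.IsCommaMorphism (k ≫ fst) → Obs.IsCommaMorphism (k ≫ snd) →
            Obs.IsCommaMorphism k) :=
  ⟨Obs.isCartesianCLTSystem_grading F φ M hCLT,
    fun h X Y Z => @h X.obj Y.obj Z.obj, fun h X Y Z => @h X.obj Y.obj Z.obj,
    fun h X Y Z => @h X.obj Y.obj Z.obj, fun h X Y Z => @h X.obj Y.obj Z.obj,
    fun h X Y Z => @h X.obj Y.obj Z.obj, fun h X Y Z => @h X.obj Y.obj Z.obj,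
    fun _ _ _ hf =>
      ⟨hf.induced_map F φ.hom, hf.induced_map F (φ.hom ≫ Functor.whiskerRight p JD)⟩,
    Obs.isCommaMorphism_grading_app F φ p,
    fun _ _ _ _ _ _ hP => (Obs.isEnrichedPullback_push_iff V).2 hP,
    fun _ _ _ f g hf hg hf₁ hg₁ =>
      have : PreservesFiniteLimits JD := PreservesLimitsOfSize.preservesFiniteLimits JD
      Obs.exists_isEnrichedPullback_isCommaMorphism V hCLT.target_pullbacks f g hf hg hf₁ hg₁⟩
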